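/- Let $N$ be a finite set of bidders and $M$ a finite set of divisible goods, let $v_{i,j}\ge 0$ be the value of bidder $i\in N$ for good $j\in M$, and suppose that for every good $j$ there is at least one bidder $i$ with $v_{i,j}>0$. Let $A\ge 1$ be a real number (the cap on multipliers). Then an auto-bidding equilibrium exists: there are multipliers $\alpha_i\in[1,A]$ $(i\in N)$, allocations $x_{i,j}\in[0,1]$ $(i\in N,\ j\in M)$, and prices $p_j$ $(j\in M)$ such that (1) goods go to the highest bidders: for all $i,j$, if $x_{i,j}>0$ then $\alpha_i v_{i,j}=\max_{k\in N}\alpha_k v_{k,j}$; (2) winners pay the second price: for all $i,j$, if $x_{i,j}>0$ then $p_j=\max_{k\ne i}\alpha_k v_{k,j}$ (the maximum over the empty set being $0$); (3) goods are fully allocated: $\sum_i x_{i,j}=1$ for every $j$; (4) ROI-feasibility: $\sum_j x_{i,j}p_j\le\sum_j x_{i,j}v_{i,j}$ for every $i$; (5) maximal pacing: $\sum_j x_{i,j}p_j=\sum_j x_{i,j}v_{i,j}$ for every $i$ with $\alpha_i\neq A$. -/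

import Mathlib

/-- The highest bid for good `j` when each bidder `k` bids `α k * v k j`
(for finitely many, and at least one, bidders the supremum is the maximum). -/
noncomputable def highestBid {N M : Type*} (v : N → M → ℝ) (α : N → ℝ) (j : M) : ℝ :=
  ⨆ k : N, α k * v k j

/-- The highest bid for good `j` among the bidders other than `i`, i.e. the second price that
bidder `i` faces. If `i` has no competitor, the real supremum over the empty family is `0`: a lone
bidder pays nothing. -/
noncomputable def highestOtherBid {N M : Type*} (v : N → M → ℝ) (α : N → ℝ) (i : N) (j : M) : ℝ :=
  ⨆ k : {k : N // k ≠ i}, α k * v k j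

/-- The conditions of an auto-bidding equilibrium `(α, x)` with prices `p`, where `v i j` is the
value of bidder `i` for good `j` and `A` is the cap on the multipliers. -/
structure IsAutoBiddingEquilibriumWithPrices {N M : Type*} [Fintype N] [Fintype M]
    (A : ℝ) (v : N → M → ℝ) (α : N → ℝ) (x : N → M → ℝ) (p : M → ℝ) : Prop where
  /-- the multipliers lie in `[1, A]` -/
  multiplier_mem : ∀ i, α i ∈ Set.Icc 1 A
  /-- allocations are fractions -/
  alloc_mem : ∀ i j, x i j ∈ Set.Icc (0 : ℝ) 1
  /-- goods go to the highest bidders -/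
  highest_bidder : ∀ i j, 0 < x i j → α i * v i j = highestBid v α j
  /-- winners pay the second price -/
  second_price : ∀ i j, 0 < x i j → p j = highestOtherBid v α i j
  /-- goods are fully allocated -/
  full_alloc : ∀ j, ∑ i, x i j = 1
  /-- no bidder spends more than the value it acquires -/
  roi_feasible : ∀ i, ∑ j, x i j * p j ≤ ∑ j, x i j * v i j
  /-- the ROI constraint binds unless the multiplier is at the cap -/
  maximal_pacing : ∀ i, α i ≠ A → ∑ j, x i j * p j = ∑ j, x i j * v i j

/-- `(α, x)` is an auto-bidding equilibrium. The prices are determined by `(α, x)`: since every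
good is fully allocated, the second-price condition fixes `p j` for each good `j`. -/
def IsAutoBiddingEquilibrium {N M : Type*} [Fintype N] [Fintype M]
    (A : ℝ) (v : N → M → ℝ) (α : N → ℝ) (x : N → M → ℝ) : Prop :=
  ∃ p : M → ℝ, IsAutoBiddingEquilibriumWithPrices A v α x p

/-!
The multipliers of an equilibrium solve a complementarity problem on the box `[1, A]^N`: a bidder
with positive ROI slack must be at the cap `A`, and a bidder with negative slack at the floor `1`.
For a slack depending continuously on the multipliers such a point exists by Brouwer's theorem
(`exists_mem_Icc_complementarity`). Second prices are continuous in the bids, but the rule that goods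
go to highest bidders is not; it is relaxed to a continuous allocation that divides a good among all
bids within `ε` of the highest one (`smoothedAlloc`). By compactness the solutions for `ε → 0`
accumulate at multipliers and an allocation for which only highest bidders win
(`exists_limit_equilibrium`). There, a winner with multiplier `1` bids its value and pays no more than
its bid, so negative slacks do not occur, and what remains are ROI-feasibility and maximal pacing.
The price is well defined because tied winners all face the highest bid as second price
(`highestOtherBid_eq_of_highest`).

Brouwer's theorem is proved analytically, after Milnor and Rogers. If `r` were a `C^1` retraction of
the unit ball onto its sphere, then `x ↦ x + t (r x - x)` would be a bijection of the ball for small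
`t`, by the inverse function theorem, so the integral of its Jacobian, a polynomial in `t`, would be
constantly the volume of the ball; at `t = 1` this Jacobian vanishes
(`not_exists_contDiffOn_retraction`). A smooth map of the ball without fixed points would give such
a retraction, and a continuous one can be approximated by a smooth one.
-/

open Set Metric MeasureTheory Topology Filter

section Brouwer

/-! ### Jacobians of small perturbations of the identity -/

theorem ContinuousLinearMap.injective_one_add_of_norm_lt_one {E : Type*}
    [NormedAddCommGroup E] [NormedSpace ℝ E] {L : E →L[ℝ] E} (h : ‖L‖ < 1) :
    Function.Injective ((1 : E →L[ℝ] E) + L) := by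
  rw [injective_iff_map_eq_zero]
  intro x hx
  by_contra hne
  have hpos : 0 < ‖x‖ := norm_pos_iff.2 hne
  have h1 : L x = -x := by
    simpa using eq_neg_of_add_eq_zero_right hx
  have h2 := L.le_opNorm x
  rw [h1, norm_neg] at h2
  nlinarith

variable {E : Type*} [NormedAddCommGroup E] [InnerProductSpace ℝ E] [FiniteDimensional ℝ E]

theorem ContinuousLinearMap.det_ne_zero_of_injective {L : E →L[ℝ] E} (h : Function.Injective L) :
    L.det ≠ 0 := by
  have : IsUnit (L : E →ₗ[ℝ] E) :=
    (LinearMap.isUnit_iff_ker_eq_bot _).2 (LinearMap.ker_eq_bot.2 h)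
  exact ((LinearMap.isUnit_iff_isUnit_det _).1 this).ne_zero

theorem ContinuousLinearMap.det_one_add_pos_of_norm_lt_one {L : E →L[ℝ] E} (h : ‖L‖ < 1) :
    0 < ((1 : E →L[ℝ] E) + L).det := by
  have hcont : Continuous fun s : ℝ => ((1 : E →L[ℝ] E) + s • L).det :=
    ContinuousLinearMap.continuous_det.comp (by fun_prop)
  by_contra! hle
  obtain ⟨s, hs, hs0⟩ := intermediate_value_Icc' zero_le_one hcont.continuousOn
    (show (0 : ℝ) ∈ _ by simpa [ContinuousLinearMap.det] using hle)
  refine ContinuousLinearMap.det_ne_zero_of_injective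
    (ContinuousLinearMap.injective_one_add_of_norm_lt_one ?_) hs0
  rw [norm_smul, Real.norm_of_nonneg hs.1]
  nlinarith [hs.2, norm_nonneg L]

/-- For every `L`, the function `t ↦ det (1 + t L)` is a polynomial of degree at most `dim E`, so by
Lagrange interpolation its value at `1` is a fixed affine combination of its values at finitely many
nodes, which can be taken in any given interval `(0, δ)`. -/
theorem exists_det_one_add_eq_sum (E : Type*) [NormedAddCommGroup E] [InnerProductSpace ℝ E]
    [FiniteDimensional ℝ E] {δ : ℝ} (hδ : 0 < δ) :
    ∃ (s : Finset ℝ) (w : ℝ → ℝ), (∀ t ∈ s, t ∈ Ioo 0 δ) ∧ ∑ t ∈ s, w t = 1 ∧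
      ∀ L : E →L[ℝ] E, ((1 : E →L[ℝ] E) + L).det =
        ∑ t ∈ s, w t * ((1 : E →L[ℝ] E) + t • L).det := by
  classical
  obtain ⟨s, hs, hcard⟩ := (Ioo_infinite hδ).exists_subset_card_eq (Module.finrank ℝ E + 1)
  have hne : s.Nonempty := Finset.card_pos.1 (by omega)
  refine ⟨s, fun t => (Lagrange.basis s id t).eval 1, fun t ht => hs ht, ?_, fun L => ?_⟩
  · rw [← Polynomial.eval_finsetSum, Lagrange.sum_basis (Function.injective_id.injOn) hne,
      Polynomial.eval_one]
  · let b := Module.finBasis ℝ E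
    let B := LinearMap.toMatrix b b (L : E →ₗ[ℝ] E)
    let p : Polynomial ℝ := ((Polynomial.X : Polynomial ℝ) • B.map Polynomial.C +
      (1 : Matrix _ _ ℝ).map Polynomial.C).det
    have hp : ∀ t : ℝ, p.eval t = ((1 : E →L[ℝ] E) + t • L).det := by
      intro t
      have h1 : ((1 : E →L[ℝ] E) + t • L).det = (1 + t • B).det := by
        rw [ContinuousLinearMap.det, ← LinearMap.det_toMatrix b]
        congr 1
        simp [B, LinearMap.toMatrix_one]
      rw [h1, ← Polynomial.coe_evalRingHom, RingHom.map_det]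
      congr 1
      ext i j
      rw [RingHom.mapMatrix_apply, Matrix.map_apply, Matrix.add_apply, Matrix.add_apply,
        Matrix.smul_apply, Matrix.smul_apply, Matrix.map_apply, Matrix.map_apply, smul_eq_mul,
        smul_eq_mul, Polynomial.coe_evalRingHom, Polynomial.eval_add, Polynomial.eval_mul,
        Polynomial.eval_X, Polynomial.eval_C, Polynomial.eval_C, add_comm]
    have hdeg : p.degree < s.card := by
      refine lt_of_le_of_lt Polynomial.degree_le_natDegree ?_
      have := Polynomial.natDegree_det_X_add_C_le B 1
      rw [Fintype.card_fin] at this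
      rw [hcard]
      exact_mod_cast Nat.lt_succ_of_le this
    have h := congrArg (Polynomial.eval 1)
      (Lagrange.eq_interpolate (v := id) Function.injective_id.injOn hdeg)
    rw [hp, one_smul, Lagrange.interpolate_apply, Polynomial.eval_finsetSum] at h
    rw [h]
    refine Finset.sum_congr rfl fun t _ => ?_
    rw [Polynomial.eval_mul, Polynomial.eval_C, id, hp, mul_comm]

/-- An injective self-map of the closed unit ball that fixes the sphere pointwise and is open at
interior points maps the open ball onto itself: the image is open, and it is relatively closed in
the connected open ball. -/
theorem image_ball_eq_ball_of_eq_on_sphere {F : E → E}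
    (hc : ContinuousOn F (closedBall 0 1))
    (hinj : InjOn F (closedBall 0 1)) (hmaps : MapsTo F (closedBall 0 1) (closedBall 0 1))
    (hS : ∀ x ∈ sphere (0 : E) 1, F x = x)
    (hopen : ∀ x ∈ ball (0 : E) 1, Filter.map F (𝓝 x) = 𝓝 (F x)) :
    F '' ball 0 1 = ball 0 1 := by
  have hsub : F '' ball 0 1 ⊆ ball 0 1 := by
    rintro _ ⟨x, hx, rfl⟩
    have hx' := ball_subset_closedBall hx
    have h1 : ‖F x‖ ≤ 1 := by simpa using hmaps hx'
    have h2 : ‖F x‖ ≠ 1 := by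
      intro h
      have hs : F x ∈ sphere (0 : E) 1 := by simpa using h
      have := hinj (sphere_subset_closedBall hs) hx' (hS _ hs)
      rw [this] at hs
      simp at hs hx
      linarith
    simpa using lt_of_le_of_ne h1 h2
  refine hsub.antisymm ?_
  have ho : IsOpen (F '' ball 0 1) := by
    rw [isOpen_iff_mem_nhds]
    rintro _ ⟨x, hx, rfl⟩
    rw [← hopen x hx]
    exact Filter.image_mem_map (isOpen_ball.mem_nhds hx)
  have hcl : IsClosed (F '' closedBall 0 1) :=
    ((isCompact_closedBall (0 : E) 1).image_of_continuousOn hc).isClosed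
  have hcov : ball (0 : E) 1 ∩ F '' closedBall 0 1 ⊆ F '' ball 0 1 := by
    rintro _ ⟨hy, x, hx, rfl⟩
    refine ⟨x, ?_, rfl⟩
    by_contra hxb
    have hxs : x ∈ sphere (0 : E) 1 := by
      simp at hx hxb ⊢
      linarith
    rw [hS x hxs] at hy
    exact hxb hy
  have hpre : IsPreconnected (ball (0 : E) 1) := (convex_ball 0 1).isPreconnected
  by_contra hnot
  obtain ⟨y, hy, hyn⟩ := not_subset.1 hnot
  obtain ⟨z, hz, hz1, hz2⟩ := hpre _ _ ho hcl.isOpen_compl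
    (fun z hz => by
      by_cases h : z ∈ F '' closedBall 0 1
      · exact Or.inl (hcov ⟨hz, h⟩)
      · exact Or.inr h)
    ⟨F 0, hsub ⟨0, by simp, rfl⟩, ⟨0, by simp, rfl⟩⟩
    ⟨y, hy, fun h => hyn (hcov ⟨hy, h⟩)⟩
  exact hz2 (image_mono ball_subset_closedBall hz1)

/-! ### Brouwer's fixed point theorem -/

/-- The derivative of a map into the unit sphere takes values orthogonal to the value of the map, so
it is not surjective. -/
theorem det_fderiv_eq_zero_of_norm_eq_one {r : E → E} {x : E} (hr : DifferentiableAt ℝ r x)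
    (h : ∀ᶠ y in 𝓝 x, ‖r y‖ = 1) : (fderiv ℝ r x).det = 0 := by
  by_contra hdet
  have hsurj : Function.Surjective (fderiv ℝ r x : E →ₗ[ℝ] E) := by
    have : IsUnit (fderiv ℝ r x : E →ₗ[ℝ] E) :=
      (LinearMap.isUnit_iff_isUnit_det _).2 (isUnit_iff_ne_zero.2 hdet)
    exact ((Module.End.isUnit_iff _).1 this).2
  obtain ⟨y, hy⟩ := hsurj (r x)
  have h1 : HasFDerivAt (fun y => ‖r y‖ ^ 2) (2 • (innerSL ℝ (r x)).comp (fderiv ℝ r x)) x :=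
    hr.hasFDerivAt.norm_sq
  have h2 : HasFDerivAt (fun y => ‖r y‖ ^ 2) (0 : E →L[ℝ] ℝ) x :=
    (hasFDerivAt_const (1 : ℝ) x).congr_of_eventuallyEq (h.mono fun y hy => by simp [hy])
  have h3 := congrArg (fun L : E →L[ℝ] ℝ => L y) (h1.unique h2)
  have h4 : fderiv ℝ r x y = r x := hy
  have h5 : ‖r x‖ = 1 := h.self_of_nhds
  simp [h4, h5] at h3

/-- There is no `C^1` retraction `r` of the unit ball onto the unit sphere. The integral over the ball
of the Jacobian of `x ↦ x + t (r x - x)` is polynomial in `t`; it is the volume of the ball for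
small `t`, hence for all `t`, but for `t = 1` the Jacobian vanishes. -/
theorem not_exists_contDiffOn_retraction {r : E → E} {U : Set E} (hU : IsOpen U)
    (hBU : closedBall 0 1 ⊆ U) (hr : ContDiffOn ℝ 1 r U)
    (hnorm : ∀ x ∈ closedBall (0 : E) 1, ‖r x‖ = 1) (hS : ∀ x ∈ sphere (0 : E) 1, r x = x) :
    False := by
  borelize E
  let μ : Measure E := Measure.addHaar
  let g : E → E := fun x => r x - x
  have hg : ContDiffOn ℝ 1 g U := hr.sub contDiffOn_id
  have hgd : ∀ x ∈ closedBall (0 : E) 1, ContDiffAt ℝ 1 g x := fun x hx =>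
    hg.contDiffAt (hU.mem_nhds (hBU hx))
  have hgc : ContinuousOn (fderiv ℝ g) (closedBall 0 1) :=
    (hg.continuousOn_fderiv_of_isOpen hU le_rfl).mono hBU
  obtain ⟨C, hC⟩ := (isCompact_closedBall (0 : E) 1).exists_bound_of_continuousOn hgc
  have hC0 : 0 ≤ C := (norm_nonneg _).trans (hC 0 (by simp))
  have hlip : ∀ x ∈ closedBall (0 : E) 1, ∀ y ∈ closedBall (0 : E) 1,
      ‖g y - g x‖ ≤ C * ‖y - x‖ := fun x hx y hy =>
    (convex_closedBall (0 : E) 1).norm_image_sub_le_of_norm_fderiv_le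
      (fun z hz => (hgd z hz).differentiableAt one_ne_zero) hC hx hy
  let F : ℝ → E → E := fun t x => x + t • g x
  have hδ : 0 < 1 / (C + 1) := by positivity
  -- Below the threshold `1 / (C + 1)`, the perturbation `F t` of the identity maps the ball
  -- bijectively to itself, so that the integral of its Jacobian is the volume of the ball.
  have hvol : ∀ t ∈ Ioo 0 (1 / (C + 1)),
      IntegrableOn (fun x => ((1 : E →L[ℝ] E) + t • fderiv ℝ g x).det) (ball 0 1) μ ∧
      ∫ x in ball 0 1, ((1 : E →L[ℝ] E) + t • fderiv ℝ g x).det ∂μ = μ.real (ball 0 1) := by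
    rintro t ⟨ht0, ht⟩
    have htC : t * (C + 1) < 1 := (lt_div_iff₀ (by positivity)).1 ht
    have ht1 : t < 1 := by nlinarith
    have hnormlt : ∀ x ∈ closedBall (0 : E) 1, ‖t • fderiv ℝ g x‖ < 1 := by
      intro x hx
      rw [norm_smul, Real.norm_of_nonneg ht0.le]
      nlinarith [hC x hx]
    have hder : ∀ x ∈ closedBall (0 : E) 1,
        HasStrictFDerivAt (F t) ((1 : E →L[ℝ] E) + t • fderiv ℝ g x) x := fun x hx =>
      (hasStrictFDerivAt_id x).add (((hgd x hx).hasStrictFDerivAt one_ne_zero).const_smul t)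
    have hpos : ∀ x ∈ ball (0 : E) 1, 0 < ((1 : E →L[ℝ] E) + t • fderiv ℝ g x).det := fun x hx =>
      ContinuousLinearMap.det_one_add_pos_of_norm_lt_one (hnormlt x (ball_subset_closedBall hx))
    have hinj : InjOn (F t) (closedBall 0 1) := by
      intro x hx y hy hxy
      have h1 : y - x = -(t • (g y - g x)) := by
        have : x + t • g x = y + t • g y := hxy
        rw [smul_sub, neg_sub, sub_eq_sub_iff_add_eq_add, ← this, add_comm]
      have h2 : ‖y - x‖ ≤ t * (C * ‖y - x‖) := by
        calc ‖y - x‖ = t * ‖g y - g x‖ := by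
              rw [h1, norm_neg, norm_smul, Real.norm_of_nonneg ht0.le]
          _ ≤ _ := by gcongr; exact hlip x hx y hy
      have h3 : ‖y - x‖ = 0 := by
        by_contra hne
        have : 0 < ‖y - x‖ := lt_of_le_of_ne (norm_nonneg _) (Ne.symm hne)
        nlinarith
      exact (sub_eq_zero.1 (norm_eq_zero.1 h3)).symm
    have hmaps : MapsTo (F t) (closedBall 0 1) (closedBall 0 1) := by
      intro x hx
      have : F t x = (1 - t) • x + t • r x := by
        simp only [F, g, smul_sub, sub_smul, one_smul]
        abel
      rw [this]
      exact convex_closedBall (0 : E) 1 hx (by simpa using (hnorm x hx).le) (by linarith) ht0.le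
        (by ring)
    have himg : F t '' ball 0 1 = ball 0 1 := by
      refine image_ball_eq_ball_of_eq_on_sphere
        (fun x hx => (hder x hx).continuousAt.continuousWithinAt) hinj hmaps
        (fun x hx => by simp [F, g, hS x hx]) (fun x hx => ?_)
      have hx' := ball_subset_closedBall hx
      refine (hder x hx').map_nhds_eq_of_surj (LinearMap.range_eq_top.2 ?_)
      exact LinearMap.surjective_of_injective
        (ContinuousLinearMap.injective_one_add_of_norm_lt_one (hnormlt x hx'))
    have hder' : ∀ x ∈ ball (0 : E) 1,
        HasFDerivWithinAt (F t) ((1 : E →L[ℝ] E) + t • fderiv ℝ g x) (ball 0 1) x := fun x hx =>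
      (hder x (ball_subset_closedBall hx)).hasFDerivAt.hasFDerivWithinAt
    have hinj' := hinj.mono ball_subset_closedBall
    constructor
    · have hcont : ContinuousOn (fun x => ((1 : E →L[ℝ] E) + t • fderiv ℝ g x).det)
          (closedBall 0 1) :=
        ContinuousLinearMap.continuous_det.comp_continuousOn
          (continuousOn_const.add (hgc.const_smul t))
      exact (hcont.integrableOn_compact (isCompact_closedBall _ _)).mono_set ball_subset_closedBall
    · have h := integral_image_eq_integral_abs_det_fderiv_smul μ measurableSet_ball hder' hinj'
        (fun _ => (1 : ℝ))
      rw [himg, setIntegral_const, smul_eq_mul, mul_one] at h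
      rw [h]
      refine setIntegral_congr_fun measurableSet_ball fun x hx => ?_
      simp [abs_of_pos (hpos x hx)]
  obtain ⟨s, w, hs, hw, hdet⟩ := exists_det_one_add_eq_sum E hδ
  have hone : ∫ x in ball 0 1, ((1 : E →L[ℝ] E) + fderiv ℝ g x).det ∂μ = μ.real (ball 0 1) := by
    have hsum : (fun x => ((1 : E →L[ℝ] E) + fderiv ℝ g x).det) =
        fun x => ∑ t ∈ s, w t * ((1 : E →L[ℝ] E) + t • fderiv ℝ g x).det :=
      funext fun x => hdet _
    rw [hsum, integral_finsetSum _ fun t ht => (hvol t (hs t ht)).1.const_mul (w t)]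
    simp_rw [integral_const_mul]
    rw [Finset.sum_congr rfl fun t ht => by rw [(hvol t (hs t ht)).2], ← Finset.sum_mul, hw, one_mul]
  have hzero : ∫ x in ball 0 1, ((1 : E →L[ℝ] E) + fderiv ℝ g x).det ∂μ = 0 := by
    refine setIntegral_eq_zero_of_forall_eq_zero fun x hx => ?_
    have hrd : DifferentiableAt ℝ r x :=
      (hr.contDiffAt (hU.mem_nhds (hBU (ball_subset_closedBall hx)))).differentiableAt one_ne_zero
    have h1 : fderiv ℝ g x = fderiv ℝ r x - 1 :=
      (hrd.hasFDerivAt.sub (hasFDerivAt_id x)).fderiv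
    rw [h1, add_sub_cancel]
    exact det_fderiv_eq_zero_of_norm_eq_one hrd
      (Filter.eventually_of_mem (isOpen_ball.mem_nhds hx)
        fun y hy => hnorm y (ball_subset_closedBall hy))
  have hball : 0 < μ.real (ball (0 : E) 1) :=
    ENNReal.toReal_pos (measure_ball_pos μ 0 one_pos).ne' measure_ball_lt_top.ne
  linarith

/-- **Brouwer's fixed point theorem** for smooth maps: if `f` had no fixed point, sending `x` to the
point where the ray from `f x` through `x` leaves the unit ball would be a `C^1` retraction. -/
theorem exists_fixedPoint_of_contDiff {f : E → E} (hf : ContDiff ℝ 1 f)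
    (hmaps : ∀ x, ‖f x‖ ≤ 1) : ∃ x, f x = x := by
  by_contra! hne
  let u : E → E := fun x => x - f x
  have hu : ContDiff ℝ 1 u := contDiff_id.sub hf
  have hu0 : ∀ x, 0 < ‖u x‖ ^ 2 := fun x => by
    have : u x ≠ 0 := sub_ne_zero.2 (hne x).symm
    positivity
  -- `x + s x • u x` has norm `1` when `s x` solves a quadratic equation with discriminant `4 D x`.
  let D : E → ℝ := fun x => inner ℝ x (u x) ^ 2 + ‖u x‖ ^ 2 * (1 - ‖x‖ ^ 2)
  have hD : ContDiff ℝ 1 D :=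
    ((contDiff_id.inner ℝ hu).pow 2).add
      ((hu.norm_sq ℝ).mul (contDiff_const.sub (contDiff_id.norm_sq ℝ)))
  let s : E → ℝ := fun x => (-inner ℝ x (u x) + √(D x)) / ‖u x‖ ^ 2
  have hin : ∀ x : E, ‖x‖ = 1 → 0 < inner ℝ x (u x) := by
    intro x hx
    have h1 : inner ℝ x (f x) < (1 : ℝ) := by
      by_contra! hge
      have h2 : ‖x - f x‖ ^ 2 = 1 - 2 * inner ℝ x (f x) + ‖f x‖ ^ 2 := by
        rw [norm_sub_sq_real, hx]; norm_num
      have h3 : ‖f x‖ ^ 2 ≤ 1 := by nlinarith [hmaps x, norm_nonneg (f x)]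
      have := hu0 x
      simp only [u] at this
      linarith
    simp only [u]
    rw [inner_sub_right, real_inner_self_eq_norm_sq, hx]
    linarith
  have hDpos : ∀ x ∈ closedBall (0 : E) 1, 0 < D x := by
    intro x hx
    have hx1 : ‖x‖ ≤ 1 := by simpa using hx
    rcases hx1.lt_or_eq with h | h
    · have : 0 < 1 - ‖x‖ ^ 2 := by nlinarith [norm_nonneg x]
      have := mul_pos (hu0 x) this
      have := sq_nonneg (inner ℝ x (u x) : ℝ)
      simp only [D]
      linarith
    · have := hin x h
      simp only [D, h]
      nlinarith
  refine not_exists_contDiffOn_retraction (r := fun x => x + s x • u x) (U := {x | 0 < D x})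
    (isOpen_lt continuous_const hD.continuous) hDpos ?_ ?_ ?_
  · have hs : ContDiffOn ℝ 1 s {x | 0 < D x} :=
      ((contDiff_id.inner ℝ hu).neg.contDiffOn.add
        (hD.contDiffOn.sqrt fun x hx => ne_of_gt hx)).div (hu.norm_sq ℝ).contDiffOn
        fun x _ => (hu0 x).ne'
    exact contDiffOn_id.add (hs.smul hu.contDiffOn)
  · intro x hx
    have h1 : s x * ‖u x‖ ^ 2 = -inner ℝ x (u x) + √(D x) := div_mul_cancel₀ _ (hu0 x).ne'
    have h2 : √(D x) ^ 2 = D x := Real.sq_sqrt (hDpos x hx).le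
    have h3 : ‖x + s x • u x‖ ^ 2 = 1 := by
      rw [norm_add_sq_real, norm_smul, inner_smul_right, mul_pow, Real.norm_eq_abs, sq_abs]
      have h4 : (s x * ‖u x‖ ^ 2 + inner ℝ x (u x)) ^ 2 = D x := by
        rw [h1, neg_add_eq_sub, sub_add_cancel, h2]
      have h5 : ‖u x‖ ^ 2 * (‖x‖ ^ 2 + 2 * (s x * inner ℝ x (u x)) + s x ^ 2 * ‖u x‖ ^ 2)
          = ‖u x‖ ^ 2 * 1 := by
        simp only [D] at h4
        linarith
      exact mul_left_cancel₀ (hu0 x).ne' h5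
    exact (pow_eq_one_iff_of_nonneg (norm_nonneg _) two_ne_zero).1 h3
  · intro x hx
    have hx1 : ‖x‖ = 1 := by simpa using hx
    have : s x = 0 := by
      simp [s, D, hx1, Real.sqrt_sq (hin x hx1).le]
    simp [this]

open scoped Manifold ContDiff in
/-- **Brouwer's fixed point theorem** for continuous maps into the unit ball, by smooth
approximation. -/
theorem exists_fixedPoint_of_continuous_of_norm_le_one {f : E → E} (hf : Continuous f)
    (hmaps : ∀ x, ‖f x‖ ≤ 1) : ∃ x, f x = x := by
  by_contra! hne
  have hpos : ∀ x ∈ closedBall (0 : E) 1, 0 < ‖f x - x‖ := fun x _ =>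
    norm_pos_iff.2 (sub_ne_zero.2 (hne x))
  obtain ⟨x₀, hx₀, hmin⟩ := (isCompact_closedBall (0 : E) 1).exists_isMinOn ⟨0, by simp⟩
    ((hf.sub continuous_id).norm.continuousOn)
  obtain ⟨g, hg⟩ := exists_contMDiffMap_forall_mem_convex_of_local_const (n := 1) 𝓘(ℝ, E)
    (F := E) (t := fun x => closedBall 0 1 ∩ ball (f x) ‖f x₀ - x₀‖)
    (fun x => (convex_closedBall _ _).inter (convex_ball _ _))
    (fun x => ⟨f x, by
      have := hf.tendsto x (ball_mem_nhds (f x) (hpos x₀ hx₀))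
      filter_upwards [this] with y hy
      exact ⟨by simpa using hmaps x, by rwa [mem_ball_comm]⟩⟩)
  obtain ⟨x, hx⟩ := exists_fixedPoint_of_contDiff (f := g) g.contMDiff.contDiff
    fun x => by simpa using (hg x).1
  have h1 := hg x
  rw [hx] at h1
  have h2 : ‖f x₀ - x₀‖ ≤ ‖f x - x‖ := hmin h1.1
  have h3 := h1.2
  rw [mem_ball, dist_comm, dist_eq_norm] at h3
  linarith

/-- **Brouwer's fixed point theorem** for continuous maps with bounded range. -/
theorem exists_fixedPoint_of_continuous_of_norm_le {f : E → E} (hf : Continuous f) {R : ℝ}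
    (hR : ∀ x, ‖f x‖ ≤ R) : ∃ x, f x = x := by
  have hR0 : 0 ≤ R := (norm_nonneg _).trans (hR 0)
  have hpos : 0 < R + 1 := by linarith
  obtain ⟨x, hx⟩ := exists_fixedPoint_of_continuous_of_norm_le_one
    (f := fun x => (R + 1)⁻¹ • f ((R + 1) • x)) (by fun_prop) fun x => by
      rw [norm_smul, norm_inv, Real.norm_of_nonneg hpos.le, inv_mul_le_iff₀ hpos]
      linarith [hR ((R + 1) • x)]
  refine ⟨(R + 1) • x, ?_⟩
  nth_rewrite 2 [← hx]
  rw [smul_inv_smul₀ hpos.ne']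

end Brouwer

/-! ### A complementarity problem on a box -/

/-- For a continuous vector field `G` there is a point of the box `[a, b]^N` whose coordinates are at
the upper bound where `G` is positive and at the lower bound where `G` is negative. -/
theorem exists_mem_Icc_complementarity {N : Type*} [Fintype N] {a b : ℝ} (hab : a ≤ b)
    {G : (N → ℝ) → N → ℝ} (hG : Continuous G) :
    ∃ α : N → ℝ, (∀ i, α i ∈ Icc a b) ∧ ∀ i, (0 < G α i → α i = b) ∧ (G α i < 0 → α i = a) := by
  -- A fixed point of `α ↦ α + G α`, truncated to the box, is such a point.
  let c : (N → ℝ) → N → ℝ := fun α i => max a (min b (α i + G α i))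
  have hc : Continuous c := by fun_prop
  have hmem : ∀ α i, c α i ∈ Icc a b := fun α i =>
    ⟨le_max_left _ _, max_le hab (min_le_left _ _)⟩
  obtain ⟨R, hR⟩ := ((isCompact_univ_pi fun _ : N => isCompact_Icc (a := a) (b := b)).image
    (PiLp.continuous_toLp 2 fun _ : N => ℝ)).isBounded.exists_norm_le
  obtain ⟨x, hx⟩ := exists_fixedPoint_of_continuous_of_norm_le
    (f := fun x : EuclideanSpace ℝ N => WithLp.toLp 2 (c (WithLp.ofLp x)))
    ((PiLp.continuous_toLp 2 _).comp (hc.comp (PiLp.continuous_ofLp 2 _)))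
    (R := R) fun x => hR _ ⟨_, fun i _ => hmem _ i, rfl⟩
  have hx' : ∀ i, c (WithLp.ofLp x) i = WithLp.ofLp x i := fun i => congrArg (fun y => y i) hx
  refine ⟨WithLp.ofLp x, fun i => hx' i ▸ hmem _ i, fun i => ?_⟩
  have h1 := hx' i
  have h2 := hmem (WithLp.ofLp x) i
  simp only [c] at h1 h2
  constructor <;> intro h <;>
  rcases max_cases a (min b (WithLp.ofLp x i + G (WithLp.ofLp x) i)) with h3 | h3 <;>
  rcases min_cases b (WithLp.ofLp x i + G (WithLp.ofLp x) i) with h4 | h4 <;> linarith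

/-! ### Bids and second prices -/

/-- The index type may be empty: the real supremum of the empty family is the constant `0`. -/
theorem continuous_iSup_real {ι X : Type*} [Finite ι] [TopologicalSpace X] {f : ι → X → ℝ}
    (hf : ∀ i, Continuous (f i)) : Continuous fun x => ⨆ i, f i x := by
  cases nonempty_fintype ι
  cases isEmpty_or_nonempty ι
  · simpa [Real.iSup_of_isEmpty] using continuous_const
  · simp_rw [← Finset.sup'_univ_eq_ciSup]
    exact Continuous.finset_sup'_apply _ fun i _ => hf i

section Auction

variable {N M : Type*} [Fintype N]

theorem continuous_highestBid (v : N → M → ℝ) (j : M) :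
    Continuous fun α : N → ℝ => highestBid v α j :=
  continuous_iSup_real fun _ => by fun_prop

theorem continuous_highestOtherBid (v : N → M → ℝ) (i : N) (j : M) :
    Continuous fun α : N → ℝ => highestOtherBid v α i j :=
  continuous_iSup_real (ι := {k : N // k ≠ i}) fun _ => by fun_prop

theorem bid_le_highestBid (v : N → M → ℝ) (α : N → ℝ) (i : N) (j : M) :
    α i * v i j ≤ highestBid v α j :=
  le_ciSup (f := fun k => α k * v k j) (Set.finite_range _).bddAbove i

theorem exists_bid_eq_highestBid [Nonempty N] (v : N → M → ℝ) (α : N → ℝ) (j : M) :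
    ∃ i, α i * v i j = highestBid v α j :=
  exists_eq_ciSup_of_finite

theorem bid_le_highestOtherBid (v : N → M → ℝ) (α : N → ℝ) {i k : N} (h : k ≠ i) (j : M) :
    α k * v k j ≤ highestOtherBid v α i j :=
  le_ciSup (f := fun l : {l : N // l ≠ i} => α l * v l j) (Set.finite_range _).bddAbove ⟨k, h⟩

theorem highestOtherBid_le_highestBid {v : N → M → ℝ} {α : N → ℝ} {j : M}
    (h : 0 ≤ highestBid v α j) (i : N) : highestOtherBid v α i j ≤ highestBid v α j :=
  Real.iSup_le (fun k => bid_le_highestBid v α k j) h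

/-- All highest bidders for a good face the same second price: if there are two of them, each one
faces the highest bid itself. -/
theorem highestOtherBid_eq_of_highest {v : N → M → ℝ} {α : N → ℝ} {j : M}
    (h : 0 ≤ highestBid v α j) {i k : N} (hi : α i * v i j = highestBid v α j)
    (hk : α k * v k j = highestBid v α j) : highestOtherBid v α i j = highestOtherBid v α k j := by
  rcases eq_or_ne i k with rfl | hne
  · rfl
  · have h1 := bid_le_highestOtherBid v α hne.symm j
    have h2 := bid_le_highestOtherBid v α hne j
    have h3 := highestOtherBid_le_highestBid h i
    have h4 := highestOtherBid_le_highestBid h k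
    linarith

end Auction

/-! ### Smoothed allocations -/

section Allocation

variable {N M : Type*}

/-- The weight of bidder `i` in the division of good `j` when bids within `ε` of the highest one
still count: positive exactly for those bids. -/
noncomputable def nearHighestWeight (ε : ℝ) (v : N → M → ℝ) (α : N → ℝ) (i : N) (j : M) : ℝ :=
  max 0 (α i * v i j - highestBid v α j + ε)

theorem nearHighestWeight_nonneg (ε : ℝ) (v : N → M → ℝ) (α : N → ℝ) (i : N) (j : M) :
    0 ≤ nearHighestWeight ε v α i j :=
  le_max_left _ _

variable [Fintype N]

/-- A continuous relaxation of the rule that goods go to the highest bidders: good `j` is divided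
among the bidders whose bids are within `ε` of the highest one, in proportion to
`nearHighestWeight`. -/
noncomputable def smoothedAlloc (ε : ℝ) (v : N → M → ℝ) (α : N → ℝ) (i : N) (j : M) : ℝ :=
  nearHighestWeight ε v α i j / ∑ k, nearHighestWeight ε v α k j

theorem sum_nearHighestWeight_pos [Nonempty N] {ε : ℝ} (hε : 0 < ε) (v : N → M → ℝ) (α : N → ℝ)
    (j : M) : 0 < ∑ k, nearHighestWeight ε v α k j := by
  obtain ⟨i, hi⟩ := exists_bid_eq_highestBid v α j
  refine Finset.sum_pos' (fun k _ => nearHighestWeight_nonneg ε v α k j) ⟨i, Finset.mem_univ i, ?_⟩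
  simpa [nearHighestWeight, hi] using hε

theorem continuous_smoothedAlloc [Nonempty N] {ε : ℝ} (hε : 0 < ε) (v : N → M → ℝ) (i : N) (j : M) :
    Continuous fun α => smoothedAlloc ε v α i j := by
  have hw : ∀ k, Continuous fun α => nearHighestWeight ε v α k j := fun k => by
    have := continuous_highestBid v j
    unfold nearHighestWeight
    fun_prop
  exact (hw i).div (continuous_finsetSum _ fun k _ => hw k)
    fun α => (sum_nearHighestWeight_pos hε v α j).ne'

theorem smoothedAlloc_nonneg (ε : ℝ) (v : N → M → ℝ) (α : N → ℝ) (i : N) (j : M) :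
    0 ≤ smoothedAlloc ε v α i j :=
  div_nonneg (nearHighestWeight_nonneg ..) (Finset.sum_nonneg fun _ _ => nearHighestWeight_nonneg ..)

theorem sum_smoothedAlloc [Nonempty N] {ε : ℝ} (hε : 0 < ε) (v : N → M → ℝ) (α : N → ℝ) (j : M) :
    ∑ i, smoothedAlloc ε v α i j = 1 := by
  simp_rw [smoothedAlloc]
  rw [← Finset.sum_div, div_self (sum_nearHighestWeight_pos hε v α j).ne']

theorem highestBid_lt_of_smoothedAlloc_pos {ε : ℝ} {v : N → M → ℝ} {α : N → ℝ} {i : N} {j : M}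
    (h : 0 < smoothedAlloc ε v α i j) : highestBid v α j < α i * v i j + ε := by
  by_contra! hle
  have : nearHighestWeight ε v α i j = 0 := max_eq_left (by linarith)
  simp [smoothedAlloc, this] at h

/-- The ROI slack of bidder `i`: the value it acquires minus its spending, where it pays for each
good the second price that it faces. -/
noncomputable def roiSlack [Fintype M] (v : N → M → ℝ) (α : N → ℝ) (x : N → M → ℝ) (i : N) : ℝ :=
  ∑ j, x i j * (v i j - highestOtherBid v α i j)

theorem continuous_roiSlack [Fintype M] (v : N → M → ℝ) (i : N) :
    Continuous fun q : (N → ℝ) × (N → M → ℝ) => roiSlack v q.1 q.2 i := by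
  have h : ∀ j, Continuous fun q : (N → ℝ) × (N → M → ℝ) => highestOtherBid v q.1 i j :=
    fun j => (continuous_highestOtherBid v i j).comp continuous_fst
  unfold roiSlack
  fun_prop

/-! ### Existence of equilibria -/

/-- Equilibrium multipliers for the smoothed allocation rule. -/
theorem exists_smoothed_equilibrium [Nonempty N] [Fintype M] {A : ℝ} (hA : 1 ≤ A) (v : N → M → ℝ)
    {ε : ℝ} (hε : 0 < ε) :
    ∃ α : N → ℝ, (∀ i, α i ∈ Icc 1 A) ∧ ∀ i,
      (0 < roiSlack v α (smoothedAlloc ε v α) i → α i = A) ∧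
      (roiSlack v α (smoothedAlloc ε v α) i < 0 → α i = 1) := by
  refine exists_mem_Icc_complementarity hA
    (G := fun α i => roiSlack v α (smoothedAlloc ε v α) i) (continuous_pi fun i => ?_)
  exact (continuous_roiSlack v i).comp (continuous_id.prodMk
    (continuous_pi fun k => continuous_pi fun j => continuous_smoothedAlloc hε v k j))

/-- A limit of smoothed equilibria as `ε → 0` allocates goods to highest bidders only and keeps the
complementarity between slacks and multipliers. -/
theorem exists_limit_equilibrium [Nonempty N] [Fintype M] {A : ℝ} (hA : 1 ≤ A) (v : N → M → ℝ) :
    ∃ (α : N → ℝ) (x : N → M → ℝ), (∀ i, α i ∈ Icc 1 A) ∧ (∀ i j, 0 ≤ x i j) ∧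
      (∀ j, ∑ i, x i j = 1) ∧ (∀ i j, 0 < x i j → α i * v i j = highestBid v α j) ∧
      ∀ i, (0 < roiSlack v α x i → α i = A) ∧ (roiSlack v α x i < 0 → α i = 1) := by
  have hε : ∀ n : ℕ, (0 : ℝ) < 1 / ((n : ℝ) + 1) := fun n => Nat.one_div_pos_of_nat
  choose a ha hcompl using fun n => exists_smoothed_equilibrium hA v (hε n)
  let y : ℕ → N → M → ℝ := fun n => smoothedAlloc (1 / ((n : ℝ) + 1)) v (a n)
  have hy1 : ∀ n i j, y n i j ≤ 1 := fun n i j => by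
    rw [← sum_smoothedAlloc (hε n) v (a n) j]
    exact Finset.single_le_sum (f := fun k => y n k j)
      (fun k _ => smoothedAlloc_nonneg _ v (a n) k j) (Finset.mem_univ i)
  obtain ⟨⟨α, x⟩, -, φ, hφ, hlim⟩ :=
    ((isCompact_Icc (a := fun _ : N => (1 : ℝ)) (b := fun _ => A)).prod
      (isCompact_Icc (a := fun (_ : N) (_ : M) => (0 : ℝ)) (b := fun _ _ => 1))).tendsto_subseq
      (x := fun n => (a n, y n)) fun n => ⟨⟨fun i => (ha n i).1, fun i => (ha n i).2⟩,
        fun i j => smoothedAlloc_nonneg _ v (a n) i j, hy1 n⟩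
  have hα : Tendsto (fun n => a (φ n)) atTop (𝓝 α) := (continuous_fst.tendsto _).comp hlim
  have hx : Tendsto (fun n => y (φ n)) atTop (𝓝 x) := (continuous_snd.tendsto _).comp hlim
  have hαi : ∀ i, Tendsto (fun n => a (φ n) i) atTop (𝓝 (α i)) := tendsto_pi_nhds.1 hα
  have hxij : ∀ i j, Tendsto (fun n => y (φ n) i j) atTop (𝓝 (x i j)) := fun i =>
    tendsto_pi_nhds.1 (tendsto_pi_nhds.1 hx i)
  have hslack : ∀ i, Tendsto (fun n => roiSlack v (a (φ n)) (y (φ n)) i) atTop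
      (𝓝 (roiSlack v α x i)) := fun i => ((continuous_roiSlack v i).tendsto _).comp hlim
  refine ⟨α, x, fun i => isClosed_Icc.mem_of_tendsto (hαi i) (.of_forall fun n => ha _ i),
    fun i j => ge_of_tendsto' (hxij i j) fun n => smoothedAlloc_nonneg _ v _ i j, fun j => ?_,
    fun i j hpos => ?_, fun i => ⟨fun h => ?_, fun h => ?_⟩⟩
  · refine tendsto_nhds_unique (tendsto_finsetSum _ fun i _ => hxij i j) ?_
    simpa only [y, sum_smoothedAlloc (hε _)] using tendsto_const_nhds
  · refine (bid_le_highestBid v α i j).antisymm ?_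
    have h1 : Tendsto (fun n => highestBid v (a (φ n)) j) atTop (𝓝 (highestBid v α j)) :=
      ((continuous_highestBid v j).tendsto _).comp hα
    have h2 : Tendsto (fun n => a (φ n) i * v i j + 1 / ((φ n : ℝ) + 1)) atTop
        (𝓝 (α i * v i j + 0)) :=
      ((hαi i).mul_const _).add (tendsto_one_div_add_atTop_nhds_zero_nat.comp hφ.tendsto_atTop)
    rw [add_zero] at h2
    refine le_of_tendsto_of_tendsto h1 h2 ?_
    filter_upwards [(hxij i j).eventually_const_lt hpos] with n hn
    exact (highestBid_lt_of_smoothedAlloc_pos hn).le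
  · refine tendsto_nhds_unique (hαi i) (tendsto_const_nhds.congr' ?_)
    filter_upwards [(hslack i).eventually_const_lt h] with n hn
    exact ((hcompl _ i).1 hn).symm
  · refine tendsto_nhds_unique (hαi i) (tendsto_const_nhds.congr' ?_)
    filter_upwards [(hslack i).eventually_lt_const h] with n hn
    exact ((hcompl _ i).2 hn).symm

end Allocation

theorem theorem1 {N M : Type*} [Fintype N] [Fintype M] (A : ℝ) (hA : 1 ≤ A)
    (v : N → M → ℝ) (hv : ∀ i j, 0 ≤ v i j) (hpos : ∀ j, ∃ i, 0 < v i j) :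
    ∃ (α : N → ℝ) (x : N → M → ℝ), IsAutoBiddingEquilibrium A v α x := by
  cases isEmpty_or_nonempty N
  · have : IsEmpty M := ⟨fun j => isEmptyElim (hpos j).choose⟩
    exact ⟨isEmptyElim, isEmptyElim, isEmptyElim, by constructor <;> exact isEmptyElim⟩
  obtain ⟨α, x, hα, hx0, hx1, hhigh, hslack⟩ := exists_limit_equilibrium (N := N) hA v
  have hα0 : ∀ i, 0 ≤ α i := fun i => zero_le_one.trans (hα i).1
  have hnonneg : ∀ j, 0 ≤ highestBid v α j := fun j => by
    obtain ⟨i, _⟩ := hpos j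
    exact (mul_nonneg (hα0 i) (hv i j)).trans (bid_le_highestBid v α i j)
  have hwin : ∀ j, ∃ i, 0 < x i j := fun j => by
    by_contra! h
    have := Finset.sum_nonpos fun i (_ : i ∈ Finset.univ) => h i
    linarith [hx1 j]
  choose win hwin using hwin
  -- The price of a good is the second price that one chosen winner faces.
  have hprice : ∀ i j, 0 < x i j → highestOtherBid v α (win j) j = highestOtherBid v α i j :=
    fun i j h => highestOtherBid_eq_of_highest (hnonneg j) (hhigh _ j (hwin j)) (hhigh i j h)
  have hslack_eq : ∀ i, roiSlack v α x i =
      ∑ j, x i j * v i j - ∑ j, x i j * highestOtherBid v α (win j) j := fun i => by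
    rw [← Finset.sum_sub_distrib]
    refine Finset.sum_congr rfl fun j _ => ?_
    rcases (hx0 i j).eq_or_lt with h | h
    · simp [← h]
    · rw [hprice i j h, mul_sub]
  -- A negative slack would force the multiplier to be `1`; but a bidder who bids its value and
  -- wins never pays more than this value.
  have hfeas : ∀ i, 0 ≤ roiSlack v α x i := fun i => by
    by_contra! hneg
    have hα1 := (hslack i).2 hneg
    refine hneg.not_ge (Finset.sum_nonneg fun j _ => ?_)
    rcases (hx0 i j).eq_or_lt with h | h
    · simp [← h]
    · have h1 := hhigh i j h
      rw [hα1, one_mul] at h1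
      exact mul_nonneg h.le (sub_nonneg.2 (h1 ▸ highestOtherBid_le_highestBid (hnonneg j) i))
  refine ⟨α, x, fun j => highestOtherBid v α (win j) j, ?_⟩
  exact
    { multiplier_mem := hα
      alloc_mem := fun i j => ⟨hx0 i j, hx1 j ▸
        Finset.single_le_sum (f := fun k => x k j) (fun k _ => hx0 k j) (Finset.mem_univ i)⟩
      highest_bidder := hhigh
      second_price := hprice
      full_alloc := hx1
      roi_feasible := fun i => by linarith [hfeas i, hslack_eq i]
      maximal_pacing := fun i hi => by
        have : roiSlack v α x i = 0 :=
          (not_lt.1 fun h => hi ((hslack i).1 h)).antisymm (hfeas i)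
        linarith [hslack_eq i] }
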